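/- Let $G$ be a discrete group (of arbitrary cardinality) and let $\lambda$ be its left regular representation on $\ell^2(G)$, $(\lambda(g)f)(h)=f(g^{-1}h)$. Let $C^*_\lambda(G)\subseteq B(\ell^2(G))$ be the reduced group C*-algebra, that is, the norm closure of the $*$-algebra generated by $\{\lambda(g): g\in G\}$. If $G$ is not amenable, then $C^*_\lambda(G)$ is not quasidiagonal. Here $G$ is called amenable if there is a left invariant mean on $\ell^\infty(G)$, and a C*-algebra $\mathcal A$ is called quasidiagonal if there is a net of contractive completely positive maps $\varphi_i:\mathcal A\to M_{k(i)}(\mathbb C)$ such that $\|\varphi_i(ab)-\varphi_i(a)\varphi_i(b)\|\to 0$ and $\|\varphi_i(a)\|\to\|a\|$ for all $a,b\in\mathcal A$. -/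

import Mathlib

open Filter Topology
open scoped ENNReal ComplexOrder CStarAlgebra

universe u

/-! ### Left translation on `ℓ^p(G)` -/

section Translation

variable {G : Type u} [Group G]

theorem memlp_leftTranslate {E : Type*} [NormedAddCommGroup E] {p : ℝ≥0∞} (g : G) {f : G → E}
    (hf : Memℓp f p) : Memℓp (fun h => f (g⁻¹ * h)) p := by
  rcases p.trichotomy with (rfl | rfl | hp)
  · exact memℓp_zero ((memℓp_zero_iff.1 hf).preimage (mul_right_injective g⁻¹).injOn)
  · refine memℓp_infty ((memℓp_infty_iff.1 hf).mono ?_)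
    rintro _ ⟨h, rfl⟩
    exact ⟨g⁻¹ * h, rfl⟩
  · exact memℓp_gen (((memℓp_gen_iff hp).1 hf).comp_injective (mul_right_injective g⁻¹))

/-- The left translation operator on `ℓ^p(G)`, that is `(g • f)(h) = f (g⁻¹ h)`. -/
def leftTranslate (𝕜 : Type*) [NormedField 𝕜] (p : ℝ≥0∞) (g : G) :
    lp (fun _ : G => 𝕜) p →ₗ[𝕜] lp (fun _ : G => 𝕜) p where
  toFun f := ⟨fun h => f (g⁻¹ * h), memlp_leftTranslate g (lp.memℓp f)⟩
  map_add' _ _ := rfl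
  map_smul' _ _ := rfl

@[simp]
theorem leftTranslate_apply (𝕜 : Type*) [NormedField 𝕜] (p : ℝ≥0∞) (g : G)
    (f : lp (fun _ : G => 𝕜) p) (h : G) : leftTranslate 𝕜 p g f h = f (g⁻¹ * h) := rfl

end Translation

/-! ### Amenability -/

/-- A discrete group `G` is amenable if there is a left invariant mean on `ℓ^∞(G)`: a positive
linear functional `m` on the bounded real functions on `G` with `m 1 = 1` and `m (g • f) = m f`. -/
def IsAmenableGroup (G : Type u) [Group G] : Prop :=
  ∃ m : lp (fun _ : G => ℝ) ∞ →ₗ[ℝ] ℝ,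
    m 1 = 1 ∧
    (∀ f : lp (fun _ : G => ℝ) ∞, (∀ h, 0 ≤ f h) → 0 ≤ m f) ∧
    ∀ (g : G) (f : lp (fun _ : G => ℝ) ∞), m (leftTranslate ℝ ∞ g f) = m f

/-! ### The reduced group C*-algebra -/

section Reduced

variable (G : Type u) [Group G]

/-- The Hilbert space `ℓ²(G)`. -/
abbrev EllTwo : Type u := lp (fun _ : G => ℂ) 2

variable {G}

/-- The left regular representation `λ(g)` on `ℓ²(G)`, `(λ(g) f)(h) = f (g⁻¹ h)`. -/
noncomputable def leftRegular (g : G) : EllTwo G →L[ℂ] EllTwo G :=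
  LinearIsometry.toContinuousLinearMap
    { leftTranslate ℂ 2 g with
      norm_map' := fun f => by
        change ‖leftTranslate ℂ 2 g f‖ = ‖f‖
        have h2 : 0 < (2 : ℝ≥0∞).toReal := by norm_num
        rw [lp.norm_eq_tsum_rpow h2, lp.norm_eq_tsum_rpow h2]
        congr 1
        exact (Equiv.mulLeft g⁻¹).tsum_eq (fun h => ‖f h‖ ^ (2 : ℝ≥0∞).toReal) }

@[simp]
theorem leftRegular_apply (g : G) (f : EllTwo G) (h : G) : leftRegular g f h = f (g⁻¹ * h) := rfl

variable (G)

/-- The reduced group C*-algebra `C*_λ(G)`: the norm closure in `B(ℓ²(G))` of the *-algebra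
generated by the operators `λ(g)`, `g ∈ G`. -/
noncomputable def reducedGroupCStarAlgebra : StarSubalgebra ℂ (EllTwo G →L[ℂ] EllTwo G) :=
  (StarAlgebra.adjoin ℂ (Set.range (leftRegular (G := G)))).topologicalClosure

instance isClosed_reducedGroupCStarAlgebra :
    IsClosed (reducedGroupCStarAlgebra G : Set (EllTwo G →L[ℂ] EllTwo G)) :=
  StarSubalgebra.isClosed_topologicalClosure _

end Reduced

/-! ### Quasidiagonality -/

/-- A C*-algebra `A` is quasidiagonal if there is a net of contractive completely positive maps
`φ i : A → M_{k i}(ℂ)` which is asymptotically multiplicative and asymptotically isometric.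
Here `CStarMatrix (Fin k) (Fin k) ℂ` is the matrix algebra `M_k(ℂ)` with the operator norm, and
positivity in `A` is the usual one (self-adjoint with nonnegative spectrum).
Index sets in the universe of `A` suffice, as a net can be replaced by one that is indexed by the
pairs of a finite subset of `A` and a natural number. -/
def IsQuasidiagonal (A : Type u) [NonUnitalCStarAlgebra A] : Prop :=
  letI : PartialOrder A := CStarAlgebra.spectralOrder A
  haveI : StarOrderedRing A := CStarAlgebra.spectralOrderedRing A
  ∃ (ι : Type u) (_ : Preorder ι) (_ : IsDirectedOrder ι) (_ : Nonempty ι) (k : ι → ℕ)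
    (φ : ∀ i, A →CP CStarMatrix (Fin (k i)) (Fin (k i)) ℂ),
    (∀ i a, ‖φ i a‖ ≤ ‖a‖) ∧
    (∀ a b, Tendsto (fun i => ‖φ i (a * b) - φ i a * φ i b‖) atTop (𝓝 0)) ∧
    ∀ a, Tendsto (fun i => ‖φ i a‖) atTop (𝓝 ‖a‖)

/-! ### The left regular representation is unitary. -/

section LeftRegular

variable {G : Type u} [Group G]

/-! Non-amenability gives a spectral gap (`exists_spectral_gap`): for some finite symmetric `S` and
some `ε > 0`, the operator `c - ∑ λ(s)` is positive, where `c = |S| - ε`.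

A completely positive `φ` into matrices transports this gap twice. Multiplying the positive kernel
of `c - ∑ λ(s)` entrywise by `φ(λ(xy⁻¹))` keeps it positive, so `c φ(1) ⊗ 1 - ∑ φ(λ(s)) ⊗ λ(s)`,
with conjugates in the first leg, is positive (`gapMatrix_nonneg`). Applying `φ` in the second leg
and testing on a matrix `q`, viewed as a vector of `ℂᵏ ⊗ ℂᵏ`, gives (`sum_gap_nonneg`) `∑ tr(φ(λ(s))
q φ(λ(s))* q*) ≤ c tr(φ(1) q φ(1)* q*)`.

If `φ` is almost multiplicative, `φ(1)` is close to a nonzero projection `q` and the `φ(λ(s))` are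
almost unitaries on its range. Each term on the left is then almost at least `tr q`, while the right
side is at most `c tr q`. Dividing by `tr q`, which is finite and positive, gives `|S|(1 - 6δ) ≤ |S|
- ε` (`card_mul_le_of_trace_le`), a contradiction for small `δ`. -/

theorem leftRegular_one : leftRegular (1 : G) = 1 := by
  ext f h
  simp

theorem leftRegular_mul (g h : G) : leftRegular (g * h) = leftRegular g * leftRegular h := by
  ext f x
  simp [mul_assoc]

theorem inner_leftRegular_right (g : G) (ξ η : EllTwo G) :
    inner ℂ ξ (leftRegular g η) = inner ℂ (leftRegular g⁻¹ ξ) η := by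
  rw [lp.inner_eq_tsum, lp.inner_eq_tsum, ← (Equiv.mulLeft g).tsum_eq]
  simp

theorem star_leftRegular (g : G) : star (leftRegular g) = leftRegular g⁻¹ := by
  rw [ContinuousLinearMap.star_eq_adjoint, eq_comm, ContinuousLinearMap.eq_adjoint_iff]
  intro ξ η
  rw [inner_leftRegular_right]

theorem norm_leftRegular_apply (g : G) (ξ : EllTwo G) : ‖leftRegular g ξ‖ = ‖ξ‖ := by
  have h : leftRegular g⁻¹ (leftRegular g ξ) = ξ := by
    ext x
    simp
  rw [@norm_eq_sqrt_re_inner ℂ, @norm_eq_sqrt_re_inner ℂ _ _ _ _ ξ, inner_leftRegular_right, h]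

end LeftRegular

/-! ### Almost invariant vectors give an invariant mean -/

section Mean

variable {G : Type u}

/-- The product of a bounded function and a square summable function. -/
noncomputable def boundedMul (f : lp (fun _ : G => ℝ) ∞) (ξ : EllTwo G) : EllTwo G :=
  ⟨fun h => (f h : ℂ) * ξ h, ((lp.memℓp ξ).norm.const_mul ‖f‖).mono fun h => by
    simpa using mul_le_mul_of_nonneg_right (lp.norm_apply_le_norm (by simp) f h)
      (norm_nonneg (ξ h))⟩

theorem boundedMul_apply (f : lp (fun _ : G => ℝ) ∞) (ξ : EllTwo G) (h : G) :
    boundedMul f ξ h = (f h : ℂ) * ξ h := rfl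

theorem norm_boundedMul_le (f : lp (fun _ : G => ℝ) ∞) (ξ : EllTwo G) :
    ‖boundedMul f ξ‖ ≤ ‖f‖ * ‖ξ‖ := by
  have : ‖boundedMul f ξ‖ ≤ ‖(‖f‖ : ℂ) • ξ‖ := by
    refine lp.norm_mono (by simp) fun h => ?_
    rw [boundedMul_apply, lp.coeFn_smul, Pi.smul_apply, norm_smul, norm_mul, Complex.norm_real,
      Complex.norm_real, norm_norm]
    exact mul_le_mul_of_nonneg_right (lp.norm_apply_le_norm (by simp) f h) (norm_nonneg (ξ h))
  rwa [norm_smul, Complex.norm_real, norm_norm] at this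

/-- The functional `f ↦ Re ⟨ξ, f ξ⟩` on bounded functions. -/
noncomputable def vectorMean (ξ : EllTwo G) : lp (fun _ : G => ℝ) ∞ →ₗ[ℝ] ℝ where
  toFun f := (inner ℂ ξ (boundedMul f ξ)).re
  map_add' f g := by
    have : boundedMul (f + g) ξ = boundedMul f ξ + boundedMul g ξ := by
      ext h
      simp [boundedMul_apply, add_mul]
    rw [this, inner_add_right, Complex.add_re]
  map_smul' c f := by
    have : boundedMul (c • f) ξ = (c : ℂ) • boundedMul f ξ := by
      ext h
      rw [lp.coeFn_smul]
      simp [boundedMul_apply, mul_assoc]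
    rw [this, inner_smul_right]
    simp

theorem vectorMean_apply (ξ : EllTwo G) (f : lp (fun _ : G => ℝ) ∞) :
    vectorMean ξ f = (inner ℂ ξ (boundedMul f ξ)).re := rfl

theorem abs_vectorMean_le (ξ : EllTwo G) (f : lp (fun _ : G => ℝ) ∞) :
    |vectorMean ξ f| ≤ ‖f‖ * ‖ξ‖ ^ 2 := by
  calc |vectorMean ξ f| ≤ ‖ξ‖ * ‖boundedMul f ξ‖ :=
        (Complex.abs_re_le_norm _).trans (norm_inner_le_norm _ _)
    _ ≤ ‖ξ‖ * (‖f‖ * ‖ξ‖) := by gcongr; exact norm_boundedMul_le f ξ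
    _ = _ := by ring

theorem vectorMean_nonneg (ξ : EllTwo G) (f : lp (fun _ : G => ℝ) ∞) (hf : ∀ h, 0 ≤ f h) :
    0 ≤ vectorMean ξ f := by
  have := Complex.hasSum_re (lp.hasSum_inner ξ (boundedMul f ξ))
  refine this.nonneg fun h => ?_
  have e : inner ℂ (ξ h) (boundedMul f ξ h) = ((f h * ‖ξ h‖ ^ 2 : ℝ) : ℂ) := by
    rw [boundedMul_apply, ← smul_eq_mul, inner_smul_right, inner_self_eq_norm_sq_to_K]
    push_cast
    rfl
  rw [e, Complex.ofReal_re]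
  have := hf h
  positivity

theorem vectorMean_one (ξ : EllTwo G) : vectorMean ξ 1 = ‖ξ‖ ^ 2 := by
  have : boundedMul 1 ξ = ξ := by
    ext h
    simp [boundedMul_apply]
  rw [vectorMean_apply, this]
  exact (norm_sq_eq_re_inner (𝕜 := ℂ) ξ).symm

theorem abs_vectorMean_sub_le (ξ η : EllTwo G) (f : lp (fun _ : G => ℝ) ∞) :
    |vectorMean ξ f - vectorMean η f| ≤ ‖f‖ * ‖ξ - η‖ * (‖ξ‖ + ‖η‖) := by
  have h1 : boundedMul f (ξ - η) = boundedMul f ξ - boundedMul f η := by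
    ext h
    simp [boundedMul_apply, mul_sub]
  have h2 : vectorMean ξ f - vectorMean η f =
      (inner ℂ (ξ - η) (boundedMul f ξ) + inner ℂ η (boundedMul f (ξ - η))).re := by
    rw [h1, vectorMean_apply, vectorMean_apply, ← Complex.sub_re]
    congr 1
    rw [inner_sub_left, inner_sub_right]
    ring
  rw [h2]
  calc _ ≤ ‖inner ℂ (ξ - η) (boundedMul f ξ)‖ + ‖inner ℂ η (boundedMul f (ξ - η))‖ :=
        (Complex.abs_re_le_norm _).trans (norm_add_le _ _)
    _ ≤ ‖ξ - η‖ * (‖f‖ * ‖ξ‖) + ‖η‖ * (‖f‖ * ‖ξ - η‖) := by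
        refine add_le_add ((norm_inner_le_norm _ _).trans ?_) ((norm_inner_le_norm _ _).trans ?_)
        · gcongr; exact norm_boundedMul_le f ξ
        · gcongr; exact norm_boundedMul_le f _
    _ = _ := by ring

variable [Group G]

/-- Multiplication by the translate of `f` is multiplication by `f` conjugated by `λ(g)`. -/
theorem vectorMean_leftTranslate (ξ : EllTwo G) (g : G) (f : lp (fun _ : G => ℝ) ∞) :
    vectorMean ξ (leftTranslate ℝ ∞ g f) = vectorMean (leftRegular g⁻¹ ξ) f := by
  have : boundedMul (leftTranslate ℝ ∞ g f) ξ =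
      leftRegular g (boundedMul f (leftRegular g⁻¹ ξ)) := by
    ext h
    simp [boundedMul_apply]
  rw [vectorMean_apply, this, inner_leftRegular_right, vectorMean_apply]

theorem isAmenableGroup_of_almost_invariant
    (H : ∀ (S : Finset G) (ε : ℝ), 0 < ε →
      ∃ ξ : EllTwo G, ‖ξ‖ = 1 ∧ ∀ s ∈ S, ‖leftRegular s ξ - ξ‖ ≤ ε) :
    IsAmenableGroup G := by
  classical
  have H' : ∀ i : Finset G × ℕ, ∃ ξ : EllTwo G, ‖ξ‖ = 1 ∧
      ∀ s ∈ i.1, ‖leftRegular s ξ - ξ‖ ≤ 1 / ((i.2 : ℝ) + 1) :=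
    fun i => H i.1 _ Nat.one_div_pos_of_nat
  choose ξ hξ hinv using H'
  -- Along an ultrafilter every bounded family `vectorMean (ξ i) f` converges, so the limit is
  -- automatically linear in `f`.
  let U : Ultrafilter (Finset G × ℕ) := Ultrafilter.of atTop
  have hU : (U : Filter (Finset G × ℕ)) ≤ atTop := Ultrafilter.of_le _
  have hlim : ∀ f, ∃ a, Tendsto (fun i => vectorMean (ξ i) f) U (𝓝 a) := by
    intro f
    have hc : IsCompact (Set.Icc (-‖f‖) ‖f‖) := isCompact_Icc
    obtain ⟨a, -, ha⟩ := hc.ultrafilter_le_nhds (U.map fun i => vectorMean (ξ i) f) (by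
      rw [le_principal_iff, Ultrafilter.coe_map, Filter.mem_map]
      refine Eventually.of_forall fun i => ?_
      simpa [hξ, abs_le] using abs_vectorMean_le (ξ i) f)
    exact ⟨a, ha⟩
  choose m hm using hlim
  refine ⟨{ toFun := m, map_add' := fun f g => ?_, map_smul' := fun c f => ?_ }, ?_, ?_, ?_⟩
  · exact tendsto_nhds_unique (hm (f + g)) (by simpa using (hm f).add (hm g))
  · exact tendsto_nhds_unique (hm (c • f)) (by simpa using (hm f).const_mul c)
  · exact tendsto_nhds_unique (hm 1) (by simp only [vectorMean_one, hξ]; simp)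
  · intro f hf
    exact ge_of_tendsto' (hm f) fun i => vectorMean_nonneg (ξ i) f hf
  · intro g f
    have hzero : Tendsto (fun i : Finset G × ℕ => ‖f‖ * (1 / ((i.2 : ℝ) + 1)) * 2) U (𝓝 0) := by
      have h2 : Tendsto (fun i : Finset G × ℕ => i.2) U atTop :=
        (tendsto_snd.mono_left (by rw [prod_atTop_atTop_eq])).mono_left hU
      simpa using ((tendsto_one_div_add_atTop_nhds_zero_nat.comp h2).const_mul ‖f‖).mul_const 2
    have hmem : ∀ᶠ i in (U : Filter (Finset G × ℕ)), g⁻¹ ∈ i.1 := by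
      refine hU ((eventually_ge_atTop (({g⁻¹} : Finset G), 0)).mono fun i hi => ?_)
      exact hi.1 (Finset.mem_singleton_self _)
    have hdiff := squeeze_zero_norm' (hmem.mono fun i hi => ?_) hzero
      (f := fun i => vectorMean (ξ i) (leftTranslate ℝ ∞ g f) - vectorMean (ξ i) f)
    · exact sub_eq_zero.1 (tendsto_nhds_unique ((hm _).sub (hm f)) hdiff)
    · rw [vectorMean_leftTranslate, Real.norm_eq_abs]
      refine (abs_vectorMean_sub_le _ _ f).trans ?_
      rw [norm_leftRegular_apply, hξ]
      have := hinv i _ hi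
      norm_num at this ⊢
      gcongr

theorem exists_spectral_gap (hG : ¬ IsAmenableGroup G) :
    ∃ (S : Finset G) (ε : ℝ), (∀ s ∈ S, s⁻¹ ∈ S) ∧ 0 < ε ∧ ε ≤ S.card ∧ ∀ ξ : EllTwo G,
      (∑ s ∈ S, inner ℂ ξ (leftRegular s ξ)).re ≤ (S.card - ε) * ‖ξ‖ ^ 2 := by
  classical
  by_contra! hcon
  refine hG (isAmenableGroup_of_almost_invariant fun S ε hε => ?_)
  -- Including `1` makes `T` nonempty, so a gap of size at most `1` satisfies `ε ≤ |T|`.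
  set T := insert 1 (S ∪ S.image (·⁻¹)) with hT
  have hTinv : ∀ s ∈ T, s⁻¹ ∈ T := fun s hs => by
    simp only [hT, Finset.mem_insert, Finset.mem_union, Finset.mem_image] at hs ⊢
    rcases hs with rfl | h | ⟨a, h, rfl⟩
    · simp
    · exact Or.inr (Or.inr ⟨s, h, rfl⟩)
    · exact Or.inr (Or.inl (by simpa using h))
  have hTcard : (1 : ℝ) ≤ T.card :=
    Nat.one_le_cast.2 (Finset.card_pos.2 ⟨1, Finset.mem_insert_self _ _⟩)
  obtain ⟨ξ, hξ⟩ := hcon T (min (ε ^ 2 / 2) 1) hTinv (by positivity)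
    ((min_le_right _ _).trans hTcard)
  have hξ0 : ξ ≠ 0 := by
    rintro rfl
    simp at hξ
  have hn : 0 < ‖ξ‖ := norm_pos_iff.2 hξ0
  -- Every other term is at most `‖ξ‖²`, so the whole defect `ε²/2` bounds that of the single term
  -- `s`; since `‖λ(s)ξ - ξ‖²` is twice this defect, it is at most `ε²‖ξ‖²`.
  have key : ∀ s ∈ T, ‖leftRegular s ξ - ξ‖ ≤ ε * ‖ξ‖ := by
    intro s hs
    have hle : ∀ t, (inner ℂ ξ (leftRegular t ξ)).re ≤ ‖ξ‖ ^ 2 := fun t => by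
      refine (Complex.re_le_norm _).trans ((norm_inner_le_norm _ _).trans_eq ?_)
      rw [norm_leftRegular_apply, sq]
    have hsum : (∑ t ∈ T.erase s, inner ℂ ξ (leftRegular t ξ)).re ≤ (T.card - 1) * ‖ξ‖ ^ 2 := by
      rw [Complex.re_sum]
      refine (Finset.sum_le_card_nsmul _ _ _ fun t _ => hle t).trans_eq ?_
      rw [nsmul_eq_mul, Finset.card_erase_of_mem hs, Nat.cast_pred (Finset.card_pos.2 ⟨s, hs⟩)]
    rw [← Finset.add_sum_erase _ _ hs, Complex.add_re] at hξ
    have hsq : ‖leftRegular s ξ - ξ‖ ^ 2 = 2 * ‖ξ‖ ^ 2 -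
        2 * (inner ℂ ξ (leftRegular s ξ)).re := by
      rw [norm_sub_rev, norm_sub_sq (𝕜 := ℂ), norm_leftRegular_apply]
      change _ - 2 * (inner ℂ ξ (leftRegular s ξ)).re + _ = _
      ring
    refine abs_le_of_sq_le_sq' ?_ (by positivity) |>.2
    rw [hsq]
    nlinarith [mul_le_mul_of_nonneg_right (min_le_left (ε ^ 2 / 2) 1) (sq_nonneg ‖ξ‖)]
  refine ⟨(‖ξ‖⁻¹ : ℂ) • ξ, ?_, fun s hs => ?_⟩
  · simp [norm_smul, hn.ne']
  · rw [map_smul, ← smul_sub, norm_smul, norm_inv, Complex.norm_real, norm_norm,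
      inv_mul_le_iff₀ hn, mul_comm]
    exact key s (Finset.mem_insert_of_mem (Finset.mem_union_left _ hs))

end Mean

/-! ### Positivity of operator-valued matrices -/

section MatrixPositivity

/-- Take `m = a⁻ = r* r`: then `m a m = -m³`, and `r m = 0` forces `m² = 0`. This reduces positivity
to a quadratic form test in `nonneg_of_inner_nonneg`. -/
theorem CStarAlgebra.exists_negPart_witness {B : Type*} [NonUnitalCStarAlgebra B] [PartialOrder B]
    [StarOrderedRing B] {a : B} (ha : IsSelfAdjoint a) :
    ∃ m r : B, star m * a * m = -(star (r * m) * (r * m)) ∧ (r * m = 0 → 0 ≤ a) := by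
  have hm0 : 0 ≤ a⁻ := CFC.negPart_nonneg a
  obtain ⟨r, hr⟩ := CStarAlgebra.nonneg_iff_eq_star_mul_self.1 hm0
  have hms : star a⁻ = a⁻ := hm0.isSelfAdjoint
  refine ⟨a⁻, r, ?_, fun h => ?_⟩
  · have : a * a⁻ = -(a⁻ * a⁻) := by
      nth_rw 1 [← CFC.posPart_sub_negPart a ha]
      rw [sub_mul, CFC.posPart_mul_negPart, zero_sub]
    rw [mul_assoc, this, star_mul, mul_assoc, ← mul_assoc (star r), ← hr, mul_neg]
  · have hmm : star a⁻ * a⁻ = 0 := by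
      rw [hms]
      nth_rw 1 [hr]
      rw [mul_assoc, h, mul_zero]
    rw [← CFC.posPart_sub_negPart a ha, (CStarRing.star_mul_self_eq_zero_iff _).1 hmm, sub_zero]
    exact CFC.posPart_nonneg a

theorem CStarAlgebra.exists_eq_star_mul_self {B : Type*} [NonUnitalCStarAlgebra B] [PartialOrder B]
    [StarOrderedRing B] {a : B} (ha : 0 ≤ a) : ∃ r : B, a = star r * r :=
  CStarAlgebra.nonneg_iff_eq_star_mul_self.1 ha

theorem CStarMatrix.sum_apply {m n ι A : Type*} [AddCommMonoid A] (t : Finset ι)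
    (f : ι → CStarMatrix m n A) (i : m) (j : n) : (∑ l ∈ t, f l) i j = ∑ l ∈ t, f l i j :=
  Matrix.sum_apply i j t f

/-- Factor `M = R* R` and flatten the blocks of `R` to a scalar matrix indexed by `m × n`. -/
theorem CStarMatrix.sum_star_mul_mul_nonneg {m n : Type*} [Fintype m] [Fintype n]
    {M : CStarMatrix m m (CStarMatrix n n ℂ)} (hM : 0 ≤ M) (v : m → n → ℂ) :
    0 ≤ ∑ i, ∑ j, ∑ a, ∑ b, star (v i a) * M i j a b * v j b := by
  obtain ⟨R, rfl⟩ := CStarAlgebra.exists_eq_star_mul_self hM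
  let R' : Matrix (m × n) (m × n) ℂ := Matrix.of fun x y => R x.1 y.1 x.2 y.2
  have h : ∀ i j a b, (star R * R) i j a b = (star R' * R') (i, a) (j, b) := by
    intro i j a b
    rw [CStarMatrix.mul_apply, CStarMatrix.sum_apply, Matrix.mul_apply, Fintype.sum_prod_type]
    rfl
  have := (Matrix.posSemidef_conjTranspose_mul_self R').dotProduct_mulVec_nonneg
    fun x => v x.1 x.2
  convert this using 1
  simp only [dotProduct, Matrix.mulVec, Fintype.sum_prod_type, Finset.mul_sum, h]
  refine Finset.sum_congr rfl fun i _ => ?_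
  rw [Finset.sum_comm]
  refine Finset.sum_congr rfl fun a _ => Finset.sum_congr rfl fun j _ =>
    Finset.sum_congr rfl fun b _ => ?_
  rw [mul_assoc]
  rfl

open scoped MatrixOrder in
theorem Matrix.PosSemidef.exists_eq_star_mul_self {ι : Type*} [Fintype ι] {Q : Matrix ι ι ℂ}
    (hQ : Q.PosSemidef) : ∃ R : Matrix ι ι ℂ, Q = star R * R := by
  classical
  exact CStarAlgebra.nonneg_iff_eq_star_mul_self.1 hQ.nonneg

end MatrixPositivity

/-! ### Positive matrices over the reduced C*-algebra. -/

section Reduced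

variable {G : Type u} [Group G]

theorem leftRegular_mem_reducedGroupCStarAlgebra (g : G) :
    leftRegular g ∈ reducedGroupCStarAlgebra G :=
  StarSubalgebra.le_topologicalClosure _ (StarAlgebra.subset_adjoin _ _ ⟨g, rfl⟩)

/-- The operator `λ(g)` as an element of the reduced group C*-algebra. -/
noncomputable def regularUnitary (g : G) : reducedGroupCStarAlgebra G :=
  ⟨leftRegular g, leftRegular_mem_reducedGroupCStarAlgebra g⟩

theorem coe_regularUnitary (g : G) :
    (regularUnitary g : EllTwo G →L[ℂ] EllTwo G) = leftRegular g := rfl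

theorem regularUnitary_one : regularUnitary (1 : G) = 1 := Subtype.ext leftRegular_one

theorem regularUnitary_mul (g h : G) :
    regularUnitary (g * h) = regularUnitary g * regularUnitary h :=
  Subtype.ext (leftRegular_mul g h)

theorem star_regularUnitary (g : G) : star (regularUnitary g) = regularUnitary g⁻¹ :=
  Subtype.ext (star_leftRegular g)

theorem norm_regularUnitary_le (g : G) : ‖regularUnitary g‖ ≤ 1 :=
  ContinuousLinearMap.opNorm_le_bound _ zero_le_one fun ξ => by
    rw [one_mul]
    exact (norm_leftRegular_apply g ξ).le

variable [PartialOrder (reducedGroupCStarAlgebra G)] [StarOrderedRing (reducedGroupCStarAlgebra G)]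

/-- This is `Q ⊗ 1` conjugated by the diagonal unitary with entries `λ(x i)`. -/
theorem nonneg_ofMatrix_smul_regularUnitary {ι : Type*} [Fintype ι] (x : ι → G)
    {Q : Matrix ι ι ℂ} (hQ : Q.PosSemidef) :
    0 ≤ CStarMatrix.ofMatrix fun i j => Q i j • regularUnitary (x i * (x j)⁻¹) := by
  obtain ⟨R, rfl⟩ := hQ.exists_eq_star_mul_self
  let P : CStarMatrix ι ι (reducedGroupCStarAlgebra G) :=
    CStarMatrix.ofMatrix (Matrix.of fun l i => R l i • regularUnitary (x i)⁻¹)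
  have hP : ∀ l i, P l i = R l i • regularUnitary (x i)⁻¹ := fun _ _ => rfl
  convert star_mul_self_nonneg P using 1
  refine CStarMatrix.ext fun i j => ?_
  change (star R * R) i j • regularUnitary (x i * (x j)⁻¹) = _
  rw [CStarMatrix.mul_apply, Matrix.mul_apply, Finset.sum_smul]
  refine Finset.sum_congr rfl fun l _ => ?_
  rw [CStarMatrix.star_apply, hP, hP, star_smul, star_regularUnitary, inv_inv, smul_mul_smul_comm,
    ← regularUnitary_mul]
  rfl

/-- On vectors of the form `mη`, with `m` the negative part, the form equals `-‖r m η‖²`; being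
nonnegative, it forces `r m` to act as zero. -/
theorem CStarMatrix.nonneg_of_inner_nonneg {n : Type*} [Fintype n]
    {N : CStarMatrix n n (reducedGroupCStarAlgebra G)} (hN : IsSelfAdjoint N)
    (h : ∀ ξ : n → EllTwo G,
      0 ≤ (∑ i, ∑ j, inner ℂ (ξ i) ((N i j : EllTwo G →L[ℂ] EllTwo G) (ξ j))).re) :
    0 ≤ N := by
  classical
  let act (P : CStarMatrix n n (reducedGroupCStarAlgebra G)) (ξ : n → EllTwo G) (i : n) :
    EllTwo G := ∑ j, (P i j : EllTwo G →L[ℂ] EllTwo G) (ξ j)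
  have act_mul : ∀ P Q ξ, act (P * Q) ξ = act P (act Q ξ) := by
    intro P Q ξ
    funext i
    simp only [act, CStarMatrix.mul_apply, map_sum]
    rw [Finset.sum_comm]
    refine Finset.sum_congr rfl fun j _ => ?_
    simp
  have act_star : ∀ P ξ η,
      ∑ i, inner ℂ (ξ i) (act (star P) η i) = ∑ i, inner ℂ (act P ξ i) (η i) := by
    intro P ξ η
    simp only [act, sum_inner, inner_sum]
    rw [Finset.sum_comm]
    refine Finset.sum_congr rfl fun i _ => Finset.sum_congr rfl fun j _ => ?_
    rw [CStarMatrix.star_apply, StarMemClass.coe_star, ContinuousLinearMap.star_eq_adjoint,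
      ContinuousLinearMap.adjoint_inner_right]
  obtain ⟨m, r, hmr, hpos⟩ := CStarAlgebra.exists_negPart_witness hN
  refine hpos ?_
  have hzero : ∀ η : n → EllTwo G, ∀ i, act (r * m) η i = 0 := by
    intro η
    have h1 : ∑ i, inner ℂ (η i) (act (star m * N * m) η i) =
        ∑ i, ∑ j, inner ℂ (act m η i) ((N i j : EllTwo G →L[ℂ] EllTwo G) (act m η j)) := by
      rw [act_mul, act_mul, act_star]
      simp only [act, inner_sum]
    have h2 : ∑ i, inner ℂ (η i) (act (star m * N * m) η i) =
        -((∑ i, ‖act (r * m) η i‖ ^ 2 : ℝ) : ℂ) := by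
      have : ∀ P i, act (-P) η i = -act P η i := by
        intro P i
        simp [act]
      simp only [hmr, this, inner_neg_right, Finset.sum_neg_distrib]
      rw [act_mul (star (r * m)), act_star]
      simp [inner_self_eq_norm_sq_to_K]
    have h3 := h (act m η)
    rw [← h1, h2, Complex.neg_re, Complex.ofReal_re] at h3
    have h4 : ∑ i, ‖act (r * m) η i‖ ^ 2 = 0 :=
      le_antisymm (by linarith) (Finset.sum_nonneg fun _ _ => by positivity)
    intro i
    have := (Finset.sum_eq_zero_iff_of_nonneg fun _ _ => by positivity).1 h4 i (Finset.mem_univ _)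
    simpa using this
  refine CStarMatrix.ext fun i j => Subtype.ext (ContinuousLinearMap.ext fun ξ => ?_)
  have := hzero (Pi.single j ξ) i
  simp only [act] at this
  rw [Finset.sum_eq_single j] at this
  · simpa using this
  · intro l _ hl
    simp [Pi.single_eq_of_ne hl]
  · simp

end Reduced

/-! ### Finitely supported vectors and the kernel of the gap operator. -/

section Kernel

variable {G : Type u}

/-- The restriction of `f` to the finite set `F`, as an element of `ℓ²(G)`. -/
noncomputable def finiteVector [DecidableEq G] (F : Finset G) (f : G → ℂ) : EllTwo G :=
  ∑ x ∈ F, lp.single 2 x (f x)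

theorem tendsto_finiteVector [DecidableEq G] (ξ : EllTwo G) :
    Tendsto (fun F => finiteVector F ξ) atTop (𝓝 ξ) :=
  lp.hasSum_single (by simp) ξ

variable [Group G]

theorem leftRegular_single [DecidableEq G] (g x : G) (c : ℂ) :
    leftRegular g (lp.single 2 x c) = lp.single 2 (g * x) c := by
  ext h
  rw [leftRegular_apply, lp.single_apply, lp.single_apply]
  by_cases hh : g⁻¹ * h = x
  · subst hh
    simp
  · rw [Pi.single_eq_of_ne hh, Pi.single_eq_of_ne]
    rintro rfl
    simp at hh

theorem inner_finiteVector [DecidableEq G] (F : Finset G) (f k : G → ℂ) (g : G) :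
    inner ℂ (finiteVector F f) (leftRegular g (finiteVector F k)) =
      ∑ x ∈ F, ∑ y ∈ F, star (f x) * (if x * y⁻¹ = g then 1 else 0) * k y := by
  simp only [finiteVector, map_sum, leftRegular_single, inner_sum, sum_inner,
    lp.inner_single_left, lp.single_apply, RCLike.inner_apply]
  rw [Finset.sum_comm]
  refine Finset.sum_congr rfl fun x _ => Finset.sum_congr rfl fun y _ => ?_
  by_cases h : x = g * y
  · subst h
    simp [mul_comm]
  · rw [Pi.single_eq_of_ne h, if_neg (by rwa [mul_inv_eq_iff_eq_mul])]
    simp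

/-- The kernel of `c - ∑_{s ∈ S} λ(s)`. -/
noncomputable def gapKernel [DecidableEq G] (S : Finset G) (c : ℝ) (g : G) : ℂ :=
  (if g = 1 then (c : ℂ) else 0) - if g ∈ S then 1 else 0

/-- The weight `ψ = 1` gives the gap operator itself; conjugated matrix entries of `φ(λ(·))` give
the entries of `gapMatrix`. -/
theorem sum_gapKernel_mul [DecidableEq G] (S : Finset G) (c : ℝ) (F : Finset G) (f k ψ : G → ℂ) :
    c * ψ 1 * inner ℂ (finiteVector F f) (leftRegular 1 (finiteVector F k)) -
        ∑ s ∈ S, ψ s * inner ℂ (finiteVector F f) (leftRegular s (finiteVector F k)) =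
      ∑ x ∈ F, ∑ y ∈ F, star (f x) * (gapKernel S c (x * y⁻¹) * ψ (x * y⁻¹)) * k y := by
  simp only [inner_finiteVector, Finset.mul_sum]
  rw [Finset.sum_comm (s := S), ← Finset.sum_sub_distrib]
  refine Finset.sum_congr rfl fun x _ => ?_
  rw [Finset.sum_comm (s := S), ← Finset.sum_sub_distrib]
  refine Finset.sum_congr rfl fun y _ => ?_
  have h : ∑ s ∈ S, ψ s * (star (f x) * (if x * y⁻¹ = s then 1 else 0) * k y) =
      if x * y⁻¹ ∈ S then ψ (x * y⁻¹) * star (f x) * k y else 0 := by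
    simp only [mul_ite, ite_mul, mul_one, mul_zero, zero_mul, Finset.sum_ite_eq, mul_assoc]
  rw [h, gapKernel]
  by_cases h1 : x * y⁻¹ = 1
  · simp only [h1, if_true]
    split_ifs <;> ring
  · simp only [h1, if_false]
    split_ifs <;> ring

/-- The matrix is the compression of `c - ∑ λ(s)` to the span of the point masses in `F`; symmetry
of `S` makes it Hermitian. -/
theorem posSemidef_gapKernel [DecidableEq G] {S : Finset G} (hS : ∀ s ∈ S, s⁻¹ ∈ S) {c : ℝ}
    (hgap : ∀ ξ : EllTwo G, (∑ s ∈ S, inner ℂ ξ (leftRegular s ξ)).re ≤ c * ‖ξ‖ ^ 2)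
    (F : Finset G) :
    (Matrix.of fun x y : F => gapKernel S c ((x : G) * (y : G)⁻¹)).PosSemidef := by
  have hherm : (Matrix.of fun x y : F => gapKernel S c ((x : G) * (y : G)⁻¹)).IsHermitian := by
    ext x y
    have h1 : ((y : G) * (x : G)⁻¹ = 1) ↔ ((x : G) * (y : G)⁻¹ = 1) := by
      rw [mul_inv_eq_one, mul_inv_eq_one, eq_comm]
    have h2 : ((y : G) * (x : G)⁻¹ ∈ S) ↔ ((x : G) * (y : G)⁻¹ ∈ S) :=
      ⟨fun h => by simpa using hS _ h, fun h => by simpa using hS _ h⟩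
    simp only [Matrix.conjTranspose_apply, Matrix.of_apply, gapKernel, h1, h2]
    split_ifs <;> simp
  refine .of_dotProduct_mulVec_nonneg hherm fun v => ?_
  let f : G → ℂ := fun x => if h : x ∈ F then v ⟨x, h⟩ else 0
  have hf : ∀ x : F, v x = f x := fun x => by simp [f]
  have key : star v ⬝ᵥ (Matrix.of fun x y : F => gapKernel S c ((x : G) * (y : G)⁻¹)).mulVec v =
      c * inner ℂ (finiteVector F f) (finiteVector F f) -
        ∑ s ∈ S, inner ℂ (finiteVector F f) (leftRegular s (finiteVector F f)) := by
    have h1 : inner ℂ (finiteVector F f) (finiteVector F f) =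
        inner ℂ (finiteVector F f) (leftRegular 1 (finiteVector F f)) := by
      rw [leftRegular_one]
      rfl
    have h2 := sum_gapKernel_mul S c F f f fun _ => 1
    simp only [mul_one, one_mul] at h2
    rw [h1, h2]
    simp only [dotProduct, Matrix.mulVec, Matrix.of_apply, Pi.star_apply, hf]
    rw [Finset.sum_coe_sort F fun x => star (f x) *
      ∑ y : F, gapKernel S c (x * (y : G)⁻¹) * f y]
    refine Finset.sum_congr rfl fun x _ => ?_
    rw [Finset.sum_coe_sort F fun y => gapKernel S c (x * y⁻¹) * f y, Finset.mul_sum]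
    simp only [mul_assoc]
  have him : (star v ⬝ᵥ
      (Matrix.of fun x y : F => gapKernel S c ((x : G) * (y : G)⁻¹)).mulVec v).im = 0 :=
    hherm.im_star_dotProduct_mulVec_self v
  rw [Complex.nonneg_iff]
  refine ⟨?_, him.symm⟩
  rw [key, Complex.sub_re, inner_self_eq_norm_sq_to_K]
  have := hgap (finiteVector F f)
  have h3 : ((c : ℂ) * ((‖finiteVector F f‖ : ℝ) : ℂ) ^ 2).re = c * ‖finiteVector F f‖ ^ 2 := by
    norm_cast
  change 0 ≤ ((c : ℂ) * ((‖finiteVector F f‖ : ℝ) : ℂ) ^ 2).re - _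
  rw [h3]
  linarith

end Kernel

/-! ### Transporting the gap through a completely positive map. -/

section CompletelyPositive

variable {G : Type u} [Group G] [PartialOrder (reducedGroupCStarAlgebra G)]
  [StarOrderedRing (reducedGroupCStarAlgebra G)] {k : ℕ}
  (φ : reducedGroupCStarAlgebra G →CP CStarMatrix (Fin k) (Fin k) ℂ)

theorem CompletelyPositiveMap.sum_gapKernel_nonneg [DecidableEq G] {S : Finset G}
    (hS : ∀ s ∈ S, s⁻¹ ∈ S) {c : ℝ}
    (hgap : ∀ ξ : EllTwo G, (∑ s ∈ S, inner ℂ ξ (leftRegular s ξ)).re ≤ c * ‖ξ‖ ^ 2)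
    (F : Finset G) (w : G → Fin k → ℂ) :
    0 ≤ ∑ x ∈ F, ∑ y ∈ F, ∑ a, ∑ b,
      star (w x a) * (gapKernel S c (x * y⁻¹) * φ (regularUnitary (x * y⁻¹)) a b) * w y b := by
  have h1 := φ.map_cstarMatrix_nonneg _ (nonneg_ofMatrix_smul_regularUnitary
    (fun x : F => (x : G)) (posSemidef_gapKernel hS hgap F))
  have h2 := CStarMatrix.sum_star_mul_mul_nonneg h1 fun x : F => w x
  rw [← Finset.sum_coe_sort F]
  convert h2 using 2 with x _
  rw [← Finset.sum_coe_sort F]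
  refine Finset.sum_congr rfl fun y _ => Finset.sum_congr rfl fun a _ =>
    Finset.sum_congr rfl fun b _ => ?_
  have : CStarMatrix.map (CStarMatrix.ofMatrix fun i j : F =>
      (Matrix.of fun x y : F => gapKernel S c ((x : G) * (y : G)⁻¹)) i j •
        regularUnitary ((i : G) * (j : G)⁻¹)) φ x y a b =
      gapKernel S c (x * (y : G)⁻¹) * φ (regularUnitary (x * (y : G)⁻¹)) a b := by
    change φ (gapKernel S c (x * (y : G)⁻¹) • regularUnitary (x * (y : G)⁻¹)) a b = _
    rw [map_smul]
    rfl
  rw [this]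

/-- The element `c φ(1) ⊗ 1 - ∑_{s ∈ S} φ(λ(s)) ⊗ λ(s)`, with complex conjugates in the first leg. -/
noncomputable def CompletelyPositiveMap.gapMatrix (S : Finset G) (c : ℝ) :
    CStarMatrix (Fin k) (Fin k) (reducedGroupCStarAlgebra G) :=
  CStarMatrix.ofMatrix (Matrix.of fun a b =>
    ((c : ℂ) * star (φ (regularUnitary 1) a b)) • regularUnitary 1 -
      ∑ s ∈ S, star (φ (regularUnitary s) a b) • regularUnitary s)

theorem CompletelyPositiveMap.gapMatrix_apply (S : Finset G) (c : ℝ) (a b : Fin k) :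
    φ.gapMatrix S c a b = ((c : ℂ) * star (φ (regularUnitary 1) a b)) • regularUnitary 1 -
      ∑ s ∈ S, star (φ (regularUnitary s) a b) • regularUnitary s := rfl

theorem CompletelyPositiveMap.star_apply_regularUnitary (g : G) (a b : Fin k) :
    star (φ (regularUnitary g) b a) = φ (regularUnitary g⁻¹) a b := by
  rw [← star_regularUnitary, map_star, CStarMatrix.star_apply]

theorem CompletelyPositiveMap.gapMatrix_nonneg {S : Finset G}
    (hS : ∀ s ∈ S, s⁻¹ ∈ S) {c : ℝ}
    (hgap : ∀ ξ : EllTwo G, (∑ s ∈ S, inner ℂ ξ (leftRegular s ξ)).re ≤ c * ‖ξ‖ ^ 2) :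
    0 ≤ φ.gapMatrix S c := by
  classical
  refine CStarMatrix.nonneg_of_inner_nonneg ?_ fun ξ => ?_
  · refine CStarMatrix.ext fun a b => ?_
    rw [CStarMatrix.star_apply, φ.gapMatrix_apply, φ.gapMatrix_apply, star_sub, star_sum]
    simp only [star_smul, star_regularUnitary, star_mul', φ.star_apply_regularUnitary,
      inv_one]
    congr 1
    · simp
    · refine Finset.sum_bij (fun s _ => s⁻¹) hS (by simp) (fun s hs => ⟨s⁻¹, hS s hs, by simp⟩) ?_
      intro s _
      rw [← φ.star_apply_regularUnitary s⁻¹]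
  · have hlim : Tendsto (fun F : Finset G => (∑ a, ∑ b, inner ℂ (finiteVector F (ξ a))
        ((φ.gapMatrix S c a b : EllTwo G →L[ℂ] EllTwo G) (finiteVector F (ξ b)))).re) atTop
        (𝓝 (∑ a, ∑ b, inner ℂ (ξ a)
          ((φ.gapMatrix S c a b : EllTwo G →L[ℂ] EllTwo G) (ξ b))).re) := by
      refine (Complex.continuous_re.tendsto _).comp (tendsto_finsetSum _ fun a _ =>
        tendsto_finsetSum _ fun b _ => ?_)
      exact (tendsto_finiteVector (ξ a)).inner
        (((ContinuousLinearMap.continuous _).tendsto _).comp (tendsto_finiteVector (ξ b)))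
    refine ge_of_tendsto' hlim fun F => ?_
    -- The test vectors are conjugated because `gapMatrix` carries conjugated coefficients: its form
    -- is the conjugate of the kernel sum.
    have h := φ.sum_gapKernel_nonneg hS hgap F fun x a => star (ξ a x)
    have hact : ∀ a b (η : EllTwo G), (φ.gapMatrix S c a b : EllTwo G →L[ℂ] EllTwo G) η =
        ((c : ℂ) * star (φ (regularUnitary 1) a b)) • leftRegular 1 η -
          ∑ s ∈ S, star (φ (regularUnitary s) a b) • leftRegular s η := by
      intro a b η
      rw [φ.gapMatrix_apply]
      simp [coe_regularUnitary]
    have hsum : ∑ a, ∑ b, inner ℂ (finiteVector F (ξ a))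
        ((φ.gapMatrix S c a b : EllTwo G →L[ℂ] EllTwo G) (finiteVector F (ξ b))) =
        star (∑ x ∈ F, ∑ y ∈ F, ∑ a, ∑ b, star (star (ξ a x)) *
          (gapKernel S c (x * y⁻¹) * φ (regularUnitary (x * y⁻¹)) a b) * star (ξ b y)) := by
      have hK : ∀ g, star (gapKernel S c g) = gapKernel S c g := by
        intro g
        rw [gapKernel]
        split_ifs <;> simp
      simp only [star_sum, star_mul', star_star, hK]
      simp only [Finset.sum_comm (s := F) (t := Finset.univ)]
      refine Finset.sum_congr rfl fun a _ => Finset.sum_congr rfl fun b _ => ?_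
      rw [hact]
      simp only [inner_sub_right, inner_smul_right, inner_sum]
      exact sum_gapKernel_mul S c F (ξ a) (ξ b) fun g => star (φ (regularUnitary g) a b)
    rw [hsum]
    exact (Complex.nonneg_iff.1 (star_nonneg_iff.2 h)).1

/-- This is the second use of complete positivity: the form of `conj φ(λ(s)) ⊗ φ(λ(s))` at the
vector `q` is a trace, which is why the first leg was conjugated. -/
theorem CompletelyPositiveMap.sum_gap_nonneg {S : Finset G}
    (hS : ∀ s ∈ S, s⁻¹ ∈ S) {c : ℝ}
    (hgap : ∀ ξ : EllTwo G, (∑ s ∈ S, inner ℂ ξ (leftRegular s ξ)).re ≤ c * ‖ξ‖ ^ 2)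
    (q : CStarMatrix (Fin k) (Fin k) ℂ) :
    0 ≤ c * ∑ i, (φ (regularUnitary 1) * q * star (φ (regularUnitary 1)) * star q) i i -
      ∑ s ∈ S, ∑ i, (φ (regularUnitary s) * q * star (φ (regularUnitary s)) * star q) i i := by
  have h := CStarMatrix.sum_star_mul_mul_nonneg
    (φ.map_cstarMatrix_nonneg _ (φ.gapMatrix_nonneg hS hgap)) fun a i => q i a
  have hmap : ∀ a b i j, CStarMatrix.map (φ.gapMatrix S c) φ a b i j =
      c * (star (φ (regularUnitary 1) a b) * φ (regularUnitary 1) i j) -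
        ∑ s ∈ S, star (φ (regularUnitary s) a b) * φ (regularUnitary s) i j := by
    intro a b i j
    rw [CStarMatrix.map_apply, φ.gapMatrix_apply, map_sub, map_sum]
    simp only [map_smul, CStarMatrix.sub_apply, CStarMatrix.sum_apply, CStarMatrix.smul_apply,
      smul_eq_mul, mul_assoc]
  have htr : ∀ f : CStarMatrix (Fin k) (Fin k) ℂ, ∑ i, (f * q * star f * star q) i i =
      ∑ a, ∑ b, ∑ i, ∑ j, star (q i a) * (star (f a b) * f i j) * q j b := by
    intro f
    simp only [CStarMatrix.mul_apply, CStarMatrix.star_apply, Finset.sum_mul]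
    rw [Finset.sum_comm]
    refine Finset.sum_congr rfl fun a _ => ?_
    rw [Finset.sum_comm]
    refine Finset.sum_congr rfl fun b _ => Finset.sum_congr rfl fun i _ =>
      Finset.sum_congr rfl fun j _ => ?_
    ring
  convert h using 1
  simp only [hmap, htr, mul_sub, sub_mul, Finset.sum_sub_distrib]
  congr 1
  · simp only [Finset.mul_sum]
    refine Finset.sum_congr rfl fun a _ => Finset.sum_congr rfl fun b _ =>
      Finset.sum_congr rfl fun i _ => Finset.sum_congr rfl fun j _ => ?_
    ring
  · rw [Finset.sum_comm]
    refine Finset.sum_congr rfl fun a _ => ?_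
    rw [Finset.sum_comm]
    refine Finset.sum_congr rfl fun b _ => ?_
    rw [Finset.sum_comm]
    refine Finset.sum_congr rfl fun i _ => ?_
    rw [Finset.sum_comm]
    refine Finset.sum_congr rfl fun j _ => ?_
    simp only [Finset.mul_sum, Finset.sum_mul]

end CompletelyPositive

/-! ### Rounding an almost idempotent to a projection. -/

section SpectralProjection

theorem CStarAlgebra.exists_isStarProjection_norm_sub_le {B : Type*} [CStarAlgebra B] {p : B}
    (hp : IsSelfAdjoint p) (hfin : (spectrum ℝ p).Finite) {δ : ℝ} (hδ : ‖p * p - p‖ ≤ δ) :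
    ∃ q : B, IsStarProjection q ∧ ‖q - p‖ ≤ 2 * δ := by
  -- Round the spectrum at `1/2`. One of `|x|`, `|x - 1|` is at least `1/2`, so `|x||x - 1| ≤ δ`
  -- bounds the other, which is the rounding error, by `2δ`.
  let g : ℝ → ℝ := fun x => if 1 / 2 ≤ x then 1 else 0
  have hg : ContinuousOn g (spectrum ℝ p) := hfin.continuousOn g
  have hspec : ∀ x ∈ spectrum ℝ p, |x * x - x| ≤ δ := by
    intro x hx
    have h1 : p * p - p = cfc (fun x : ℝ => x * x - x) p := by
      rw [cfc_sub (fun x : ℝ => x * x) (fun x => x) p, cfc_mul (fun x : ℝ => x) (fun x => x) p,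
        cfc_id' ℝ p]
    rw [h1] at hδ
    exact (norm_apply_le_norm_cfc (fun x : ℝ => x * x - x) p hx).trans hδ
  refine ⟨cfc g p, ⟨?_, cfc_predicate g p⟩, ?_⟩
  · rw [IsIdempotentElem, ← cfc_mul g g p]
    congr 1
    funext x
    simp only [g]
    split_ifs <;> simp
  · have h0 : 0 ≤ δ := (norm_nonneg _).trans hδ
    have h1 : cfc g p - p = cfc (fun x : ℝ => g x - x) p := by
      rw [cfc_sub g (fun x => x) p, cfc_id' ℝ p]
    rw [h1]
    refine norm_cfc_le (by positivity) fun x hx => ?_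
    have h2 := abs_le.1 (hspec x hx)
    rw [Real.norm_eq_abs, abs_le]
    simp only [g]
    split_ifs with h
    · constructor <;> nlinarith
    · have h := not_le.1 h
      constructor <;> nlinarith

end SpectralProjection

/-! ### The trace on complex matrices. -/

section Trace

variable {n : Type*} [Fintype n]

/-- The trace of a complex matrix, viewed as an element of a C*-algebra. -/
def CStarMatrix.trace (M : CStarMatrix n n ℂ) : ℂ := ∑ i, M i i

theorem CStarMatrix.trace_mul_comm (M N : CStarMatrix n n ℂ) :
    (M * N).trace = (N * M).trace :=
  Matrix.trace_mul_comm (CStarMatrix.ofMatrix.symm M) (CStarMatrix.ofMatrix.symm N)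

theorem CStarMatrix.trace_sub (M N : CStarMatrix n n ℂ) :
    (M - N).trace = M.trace - N.trace :=
  Matrix.trace_sub (CStarMatrix.ofMatrix.symm M) (CStarMatrix.ofMatrix.symm N)

theorem CStarMatrix.trace_star_mul_self (M : CStarMatrix n n ℂ) :
    (star M * M).trace = ((∑ i, ∑ j, ‖M j i‖ ^ 2 : ℝ) : ℂ) := by
  simp only [CStarMatrix.trace, CStarMatrix.mul_apply, CStarMatrix.star_apply]
  push_cast
  refine Finset.sum_congr rfl fun i _ => Finset.sum_congr rfl fun j _ => ?_
  exact Complex.conj_mul' _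

theorem CStarMatrix.trace_re_nonneg {M : CStarMatrix n n ℂ} (hM : 0 ≤ M) : 0 ≤ M.trace.re := by
  obtain ⟨R, rfl⟩ := CStarAlgebra.exists_eq_star_mul_self hM
  rw [CStarMatrix.trace_star_mul_self, Complex.ofReal_re]
  positivity

theorem CStarMatrix.trace_re_mono {M N : CStarMatrix n n ℂ} (h : M ≤ N) :
    M.trace.re ≤ N.trace.re := by
  have := CStarMatrix.trace_re_nonneg (sub_nonneg.2 h)
  rw [CStarMatrix.trace_sub, Complex.sub_re] at this
  linarith

theorem CStarMatrix.trace_re_pos {q : CStarMatrix n n ℂ} (hq : IsStarProjection q) (h0 : q ≠ 0) :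
    0 < q.trace.re := by
  have h1 : q = star q * q := by rw [hq.isSelfAdjoint.star_eq, hq.isIdempotentElem.eq]
  rw [h1, CStarMatrix.trace_star_mul_self, Complex.ofReal_re]
  by_contra hcon
  have hz : ∑ i, ∑ j, ‖q j i‖ ^ 2 = 0 := le_antisymm (not_lt.1 hcon) (by positivity)
  refine h0 (CStarMatrix.ext fun j i => ?_)
  have h2 := (Finset.sum_eq_zero_iff_of_nonneg fun _ _ => by positivity).1 hz i (Finset.mem_univ _)
  have h3 := (Finset.sum_eq_zero_iff_of_nonneg fun _ _ => by positivity).1 h2 j (Finset.mem_univ _)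
  simpa using h3

theorem CStarAlgebra.conjugate_le_norm_smul_of_isStarProjection {B : Type*} [CStarAlgebra B]
    [PartialOrder B] [StarOrderedRing B] {q a : B} (hq : IsStarProjection q)
    (ha : IsSelfAdjoint a) : q * a * q ≤ ‖a‖ • q := by
  have := CStarAlgebra.star_left_conjugate_le_norm_smul (a := q) (b := a) ha
  rwa [hq.isSelfAdjoint.star_eq, hq.isIdempotentElem.eq] at this

theorem CStarMatrix.trace_conjugate_re_le {q a : CStarMatrix n n ℂ} (hq : IsStarProjection q)
    (ha : IsSelfAdjoint a) : (q * a * q).trace.re ≤ ‖a‖ * q.trace.re := by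
  classical
  refine (CStarMatrix.trace_re_mono
    (CStarAlgebra.conjugate_le_norm_smul_of_isStarProjection hq ha)).trans_eq ?_
  have : (‖a‖ • q).trace = (‖a‖ : ℂ) * q.trace := by
    simp only [CStarMatrix.trace, CStarMatrix.smul_apply, Complex.real_smul, Finset.mul_sum]
  exact (congrArg Complex.re this).trans (Complex.re_ofReal_mul _ _)

theorem CStarMatrix.finite_spectrum [DecidableEq n] (p : CStarMatrix n n ℂ) :
    (spectrum ℝ p).Finite := by
  have h : (spectrum ℂ (CStarMatrix.ofMatrix.symm p)).Finite := Matrix.finite_spectrum _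
  have h2 : spectrum ℂ p = spectrum ℂ (CStarMatrix.ofMatrix.symm p) := rfl
  rw [← spectrum.preimage_algebraMap ℂ, h2]
  exact h.preimage (Complex.ofReal_injective.injOn)

end Trace

/-! ### The trace comparison and the conclusion. -/

theorem CStarMatrix.card_mul_le_of_trace_le {n ι : Type*} [Fintype n] [DecidableEq n]
    {S : Finset ι} {f : ι → CStarMatrix n n ℂ} {p : CStarMatrix n n ℂ} {c δ : ℝ} (hc : 0 ≤ c)
    (hp : IsSelfAdjoint p) (hp1 : ‖p‖ ≤ 1) (hpδ : 2 * δ < ‖p‖) (hpp : ‖p * p - p‖ ≤ δ)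
    (hf : ∀ s ∈ S, ‖f s‖ ≤ 1) (hff : ∀ s ∈ S, ‖f s * star (f s) - p‖ ≤ δ)
    (hfp : ∀ s ∈ S, ‖f s * p - f s‖ ≤ δ)
    (H : ∀ q, IsSelfAdjoint q → ∑ s ∈ S, (f s * q * star (f s) * q).trace.re ≤
      c * (p * q * p * q).trace.re) :
    S.card * (1 - 6 * δ) ≤ c := by
  obtain ⟨q, hq, hqp⟩ := CStarAlgebra.exists_isStarProjection_norm_sub_le hp
    (CStarMatrix.finite_spectrum p) hpp
  have hq0 : q ≠ 0 := by
    rintro rfl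
    rw [zero_sub, norm_neg] at hqp
    linarith
  have ht := CStarMatrix.trace_re_pos hq hq0
  have hcyc : ∀ a : CStarMatrix n n ℂ, (a * q).trace = (q * a * q).trace := by
    intro a
    rw [CStarMatrix.trace_mul_comm (q * a), ← mul_assoc, hq.isIdempotentElem.eq,
      CStarMatrix.trace_mul_comm]
  have hlower : ∀ s ∈ S, (1 - 6 * δ) * q.trace.re ≤ (f s * q * star (f s) * q).trace.re := by
    intro s hs
    have hsf : ‖star (f s)‖ ≤ 1 := (norm_star (f s)).le.trans (hf s hs)
    -- The four summands below contribute `2δ + δ + δ + 2δ`.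
    have hb : ‖q - f s * q * star (f s)‖ ≤ 6 * δ := by
      have e : q - f s * q * star (f s) = (q - p) - (f s * star (f s) - p) -
          (f s * p - f s) * star (f s) - f s * (q - p) * star (f s) := by
        noncomm_ring
      rw [e]
      have h1 : ‖(f s * p - f s) * star (f s)‖ ≤ δ * 1 :=
        (norm_mul_le _ _).trans (mul_le_mul (hfp s hs) hsf (norm_nonneg _)
          ((norm_nonneg _).trans hpp))
      have h2 : ‖f s * (q - p)‖ ≤ 1 * (2 * δ) :=
        (norm_mul_le _ _).trans (mul_le_mul (hf s hs) hqp (norm_nonneg _) zero_le_one)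
      have h3 : ‖f s * (q - p) * star (f s)‖ ≤ 1 * (2 * δ) * 1 :=
        (norm_mul_le _ _).trans (mul_le_mul h2 hsf (norm_nonneg _)
          ((norm_nonneg _).trans h2))
      have h4 := norm_sub_le (q - p) (f s * star (f s) - p)
      have h5 := norm_sub_le ((q - p) - (f s * star (f s) - p)) ((f s * p - f s) * star (f s))
      have h6 := norm_sub_le ((q - p) - (f s * star (f s) - p) - (f s * p - f s) * star (f s))
        (f s * (q - p) * star (f s))
      have := hff s hs
      linarith
    have hsa : IsSelfAdjoint (q - f s * q * star (f s)) :=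
      hq.isSelfAdjoint.sub (hq.isSelfAdjoint.conjugate (f s))
    -- Compressing by `q` makes the error relative to `tr q`, so the matrix size does not enter.
    have h7 := CStarMatrix.trace_conjugate_re_le hq hsa
    have h8 : q * (q - f s * q * star (f s)) * q = q - q * (f s * q * star (f s)) * q := by
      rw [mul_sub, sub_mul, hq.isIdempotentElem.eq, hq.isIdempotentElem.eq]
    rw [h8, CStarMatrix.trace_sub, Complex.sub_re, ← hcyc] at h7
    nlinarith
  have hupper : (p * q * p * q).trace.re ≤ q.trace.re := by
    have hpq : ‖p * q * p‖ ≤ 1 := by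
      have hq1 : ‖q‖ ≤ 1 := hq.norm_le
      calc ‖p * q * p‖ ≤ ‖p‖ * ‖q‖ * ‖p‖ := (norm_mul_le _ _).trans
            (mul_le_mul_of_nonneg_right (norm_mul_le _ _) (norm_nonneg _))
        _ ≤ 1 * 1 * 1 := by gcongr
        _ = 1 := by norm_num
    have hsa : IsSelfAdjoint (p * q * p) := by
      have := hq.isSelfAdjoint.conjugate p
      rwa [hp.star_eq] at this
    have h7 := CStarMatrix.trace_conjugate_re_le hq hsa
    rw [hcyc]
    nlinarith
  have h1 := Finset.sum_le_sum hlower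
  rw [Finset.sum_const, nsmul_eq_mul] at h1
  have h2 := (h1.trans (H q hq.isSelfAdjoint)).trans (mul_le_mul_of_nonneg_left hupper hc)
  rw [← mul_assoc] at h2
  exact le_of_mul_le_mul_right h2 ht

theorem mainTheorem7 (G : Type u) [Group G] (hG : ¬ IsAmenableGroup G) :
    ¬ IsQuasidiagonal (reducedGroupCStarAlgebra G) := by
  obtain ⟨S, ε, hS, hε, hεS, hgap⟩ := exists_spectral_gap hG
  let : PartialOrder (reducedGroupCStarAlgebra G) :=
    CStarAlgebra.spectralOrder (reducedGroupCStarAlgebra G)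
  have : StarOrderedRing (reducedGroupCStarAlgebra G) :=
    CStarAlgebra.spectralOrderedRing (reducedGroupCStarAlgebra G)
  rintro ⟨ι, _, _, _, k, φ, hcontr, hmul, hnorm⟩
  have hS0 : (0 : ℝ) < S.card := hε.trans_le hεS
  -- The bound `2δ < 1/2`, with `‖φ i 1‖ > 1/2` eventually, keeps the rounded projection nonzero;
  -- `6δ|S| < ε` contradicts the final count.
  obtain ⟨δ, hδ0, hδ1, hδ2⟩ : ∃ δ : ℝ, 0 < δ ∧ 2 * δ < 1 / 2 ∧ S.card * (6 * δ) < ε := by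
    refine ⟨min (1 / 8) (ε / (12 * S.card)), by positivity, ?_, ?_⟩
    · have := min_le_left (1 / 8 : ℝ) (ε / (12 * S.card))
      linarith
    · have := min_le_right (1 / 8 : ℝ) (ε / (12 * S.card))
      calc _ ≤ S.card * (6 * (ε / (12 * S.card))) := by gcongr
        _ = ε / 2 := by field_simp; norm_num
        _ < ε := by linarith
  have hnorm1 : ‖(1 : reducedGroupCStarAlgebra G)‖ = 1 := by
    have : Nontrivial (reducedGroupCStarAlgebra G) := by
      refine ⟨1, 0, fun h => ?_⟩
      classical
      have h1 := congrArg (fun T : reducedGroupCStarAlgebra G =>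
        (T : EllTwo G →L[ℂ] EllTwo G) (lp.single 2 1 1) 1) h
      simp at h1
    exact CStarRing.norm_one
  have ev1 : ∀ a b, ∀ᶠ i in atTop, ‖φ i (a * b) - φ i a * φ i b‖ < δ := fun a b =>
    (hmul a b).eventually_lt_const hδ0
  have ev2 : ∀ᶠ i in atTop, 1 / 2 < ‖φ i 1‖ :=
    (hnorm 1).eventually_const_lt (by rw [hnorm1]; norm_num)
  have ev3 : ∀ᶠ i in atTop, ∀ s ∈ S,
      ‖φ i (regularUnitary s * star (regularUnitary s)) -
        φ i (regularUnitary s) * φ i (star (regularUnitary s))‖ < δ ∧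
      ‖φ i (regularUnitary s * 1) - φ i (regularUnitary s) * φ i 1‖ < δ :=
    (Filter.eventually_all_finset S).2 fun s _ => (ev1 _ _).and (ev1 _ _)
  obtain ⟨i, h1, h2, h3⟩ := ((ev1 1 1).and (ev2.and ev3)).exists
  have hfin := CStarMatrix.card_mul_le_of_trace_le (S := S) (f := fun s => φ i (regularUnitary s))
    (p := φ i 1) (c := S.card - ε) (δ := δ) (by linarith)
    (by rw [IsSelfAdjoint, ← map_star, star_one]) ((hcontr i 1).trans_eq hnorm1)
    (hδ1.trans h2) (by rw [norm_sub_rev]; simpa using h1.le)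
    (fun s _ => (hcontr i _).trans (norm_regularUnitary_le s))
    (fun s hs => by
      have := (h3 s hs).1.le
      rwa [star_regularUnitary, ← regularUnitary_mul, mul_inv_cancel, regularUnitary_one,
        ← star_regularUnitary, map_star, norm_sub_rev] at this)
    (fun s hs => by
      have := (h3 s hs).2.le
      rwa [mul_one, norm_sub_rev] at this)
    (fun q hq => by
      have := (Complex.nonneg_iff.1 ((φ i).sum_gap_nonneg hS hgap q)).1
      have hps : star (φ i 1) = φ i 1 := by rw [← map_star, star_one]
      rw [regularUnitary_one, hps, hq.star_eq, Complex.sub_re, Complex.re_ofReal_mul] at this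
      simp only [CStarMatrix.trace, Complex.re_sum] at this ⊢
      linarith)
  linarith
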